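/- Let $p\ge 1$ be an integer, let $d\ge 0$ be an integer, and let $G=(V,E)$ be a finite simple graph with $n=|V|$. For $r:V\to\mathbb R^d$ put $\ell_{uv}(r)=\|r(u)-r(v)\|_p$. The $d$-dimensional stratum $\Phi^d_{n,l_p}\subseteq\mathbb R^{\binom n2}$ of the $l_p^p$ distance cone is the set of all vectors $(\ell_{uv}(r)^p)_{\{u,v\}}$, indexed by the pairs of distinct vertices, where $r$ ranges over all maps $V\to\mathbb R^d$. Let $\Phi^d_{G,l_p}\subseteq\mathbb R^E$ be its image under the coordinate projection onto the edges of $G$. For a graph $H$ on $V$, a framework $(H,r)$ with $r:V\to\mathbb R^d$ is well-positioned if $\|\cdot\|_p$ is differentiable at $r(u)-r(v)$ for every edge $uv$ of $H$. Its rigidity matrix is the $|E(H)|\times d|V|$ Jacobian matrix at $r$ of the map $s\mapsto(\ell_{e}(s))_{e\in E(H)}$. A well-positioned framework $(H,r)$ is regular if the rank of its rigidity matrix is maximal among all well-positioned frameworks of $H$ in $\mathbb R^d$. A set $F$ of pairs of vertices is independent in the generic $d$-dimensional $l_p$ rigidity matroid if the rigidity matrix of a well-positioned and regular framework of $(V,F)$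 has linearly independent rows, and the rank of $G$ in this matroid is the largest size of an independent subset of $E$. Then the rank of $G$ in the generic $d$-dimensional $l_p$ rigidity matroid equals the (Hausdorff) dimension of $\Phi^d_{G,l_p}$. -/

import Mathlib

open scoped ENNReal

noncomputable section

namespace LpRigidity

/-- The `l_p` norm on `ℝ^d`. -/
def lpNorm (p : ℕ) {d : ℕ} (x : Fin d → ℝ) : ℝ := ‖WithLp.toLp (p : ℝ≥0∞) x‖

theorem lpNorm_sub_comm (p : ℕ) {d : ℕ} (x y : Fin d → ℝ) :
    lpNorm p (x - y) = lpNorm p (y - x) := by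
  rcases Nat.eq_zero_or_pos p with rfl | hp
  · have h : ∀ z : Fin d → ℝ, lpNorm 0 z = {i | z i ≠ 0}.ncard := fun z => by
      rw [lpNorm, Nat.cast_zero, PiLp.norm_eq_card, Set.ncard_eq_toFinset_card']
      congr 2
      ext i
      simp
    rw [h, h]
    simp only [Pi.sub_apply, sub_ne_zero, ne_comm]
  · have h : 0 < (p : ℝ≥0∞).toReal := by simpa using hp
    simp only [lpNorm, PiLp.norm_eq_sum h, Pi.sub_apply, norm_sub_rev]

/-- The `l_p` length `‖r u - r v‖_p` of the pair `e = {u, v}` in the point configuration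
(framework) `r : V → ℝ^d`. -/
def edgeLength {V : Type*} (p : ℕ) {d : ℕ} (r : V → Fin d → ℝ) (e : Sym2 V) : ℝ :=
  Sym2.lift ⟨fun u v => lpNorm p (r u - r v), fun u v => lpNorm_sub_comm p (r u) (r v)⟩ e

/-! ### The stratum of the distance cone and its projections -/

/-- The `d`-dimensional stratum of the cone of `l_p^p` distance vectors of point configurations
indexed by `V`: the vectors, with one coordinate for each pair of distinct points (that is, each
edge of the complete graph), of the `p`-th powers of the pairwise `l_p` distances of a
configuration in `ℝ^d`. -/
def stratum (V : Type*) (p d : ℕ) : Set ((⊤ : SimpleGraph V).edgeSet → ℝ) :=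
  Set.range fun (r : V → Fin d → ℝ) e => edgeLength p r e ^ p

/-- The coordinate projection from vectors indexed by all pairs onto vectors indexed by the
edges of `G`. -/
def edgeProjection {V : Type*} (G : SimpleGraph V)
    (δ : (⊤ : SimpleGraph V).edgeSet → ℝ) : G.edgeSet → ℝ :=
  fun e => δ ⟨e, SimpleGraph.edgeSet_mono le_top e.2⟩

/-- The projection of the `d`-dimensional stratum onto the edges of `G`. -/
def projectedStratum {V : Type*} (p d : ℕ) (G : SimpleGraph V) : Set (G.edgeSet → ℝ) :=
  edgeProjection G '' stratum V p d

/-! ### Rigidity in `l_p` -/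

/-- The framework `(G, r)` is well-positioned: for every edge `uv` the norm is differentiable at
`r u - r v`. (For `p = 1` this says that `r u - r v` lies in the cone over only one facet of the
unit ball.) -/
def WellPositioned {V : Type*} (p : ℕ) {d : ℕ} (G : SimpleGraph V) (r : V → Fin d → ℝ) : Prop :=
  ∀ u v, G.Adj u v → DifferentiableAt ℝ (lpNorm p (d := d)) (r u - r v)

variable {V : Type*} [Fintype V] [DecidableEq V]

/-- The rigidity matrix of a framework `(G, r)`: the Jacobian matrix at `r` of the map that takes a
configuration to its vector of edge lengths. There is one row for each edge and there are
`d` columns for each vertex. -/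
def rigidityMatrix (p : ℕ) {d : ℕ} (G : SimpleGraph V) (r : V → Fin d → ℝ) :
    Matrix G.edgeSet (V × Fin d) ℝ :=
  Matrix.of fun e c =>
    fderiv ℝ (fun s : V → Fin d → ℝ => edgeLength p s e) r (Pi.single c.1 (Pi.single c.2 1))

/-- A well-positioned framework is regular if its rigidity matrix has maximal rank among all
well-positioned frameworks of the same graph in the same dimension. -/
def IsRegular (p : ℕ) {d : ℕ} (G : SimpleGraph V) (r : V → Fin d → ℝ) : Prop :=
  WellPositioned p G r ∧ ∀ s : V → Fin d → ℝ, WellPositioned p G s →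
    (rigidityMatrix p G s).rank ≤ (rigidityMatrix p G r).rank

/-- The edge set of `H` is independent in the generic `d`-dimensional `l_p` rigidity matroid: the
rigidity matrix of a well-positioned and regular framework of `H` has independent rows. -/
def IsIndependent (p d : ℕ) (H : SimpleGraph V) : Prop :=
  ∃ r : V → Fin d → ℝ, IsRegular p H r ∧ LinearIndependent ℝ (rigidityMatrix p H r).row

/-- The rank of `G` in the generic `d`-dimensional `l_p` rigidity matroid: the largest size of an
independent set of edges of `G`. -/
def rigidityRank (p d : ℕ) (G : SimpleGraph V) : ℕ :=
  sSup {k | ∃ H : SimpleGraph V, H ≤ G ∧ IsIndependent p d H ∧ H.edgeSet.ncard = k}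

end LpRigidity

end

/-! Lower bound. Let `H ≤ G` be independent, with a witnessing framework `r`. The `p`-th powers of
edge lengths form a map that is `C^1` at `r`, and its derivative is the rigidity matrix with rows
scaled by the nonzero factors `p ℓ_e ^ (p - 1)`. It is therefore surjective, so the image contains
an open set of `ℝ^{E(H)}`; a coordinate projection does not raise dimension.

Upper bound. Once the signs of all coordinate differences are fixed, `ℓ_e ^ p` is a polynomial, so
finitely many polynomial images cover the stratum. Let `m` be the generic rank of the Jacobian of
one such polynomial map `F`. At a suitable point of the open sign cone its rows are multiples of
rows of a rigidity matrix, so `m` is at most the rigidity rank. It remains to bound the dimension of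
the image of `F` by `m`.

This is done by counting polynomials. Some `m`-dimensional coordinate slice detects every nonzero
element of `ℝ[F]`, so polynomials of degree at most `D` on the image span dimension `O(D) ^ m`
(`HasPolynomialGrowth.range_eval`). Conversely, a separated set of `L` points carries `L`
independent peak polynomials built from Chebyshev polynomials, of degree about `log L / ε`. Hence
packing numbers at scale `ε` grow more slowly than `ε ^ (-s)` for every `s > m`
(`HasPolynomialGrowth.dimH_le`). -/

/-! ### Polynomial growth bounds Hausdorff dimension -/

open Polynomial in
theorem MvPolynomial.totalDegree_polynomial_aeval_le {ι R : Type*} [CommRing R]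
    (q : R[X]) (P : MvPolynomial ι R) :
    (Polynomial.aeval P q).totalDegree ≤ q.natDegree * P.totalDegree := by
  rw [Polynomial.aeval_eq_sum_range]
  refine MvPolynomial.totalDegree_finsetSum_le fun i hi => ?_
  refine (MvPolynomial.totalDegree_smul_le _ _).trans ((MvPolynomial.totalDegree_pow _ _).trans ?_)
  exact Nat.mul_le_mul_right _ (Nat.lt_succ_iff.mp (Finset.mem_range.mp hi))

/-- A set on which the space of polynomials of degree at most `D` has dimension at most
`(C * D + 1) ^ m`. -/
def HasPolynomialGrowth {ι : Type*} (T : Set (ι → ℝ)) (C m : ℕ) : Prop :=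
  ∀ (D L : ℕ) (Q : Fin L → MvPolynomial ι ℝ), (∀ i, (Q i).totalDegree ≤ D) →
    LinearIndependent ℝ (fun i (x : T) => MvPolynomial.eval x.1 (Q i)) → L ≤ (C * D + 1) ^ m

theorem linearIndependent_of_diagonally_dominant {L : ℕ} {T : Type*} (K : Fin L → T → ℝ)
    (y : Fin L → T) {a : ℝ} (ha : (L : ℝ) ≤ a) (hd : ∀ i, a ≤ |K i (y i)|)
    (hK : ∀ i j, i ≠ j → |K i (y j)| ≤ 1) : LinearIndependent ℝ K := by
  let A : Matrix (Fin L) (Fin L) ℝ := Matrix.of fun i j => K i (y j)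
  have hA : A.det ≠ 0 := by
    refine det_ne_zero_of_sum_row_lt_diag fun k => ?_
    have hL : 0 < L := k.pos
    calc ∑ j ∈ Finset.univ.erase k, ‖A k j‖ ≤ ∑ j ∈ Finset.univ.erase k, (1 : ℝ) :=
          Finset.sum_le_sum fun j hj => hK k j (Finset.ne_of_mem_erase hj).symm
      _ = ((L - 1 : ℕ) : ℝ) := by simp
      _ < L := by exact_mod_cast Nat.sub_lt hL one_pos
      _ ≤ ‖A k k‖ := ha.trans (hd k)
  have h := Matrix.linearIndependent_rows_of_det_ne_zero hA
  exact LinearIndependent.of_comp (LinearMap.funLeft ℝ ℝ y) h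

-- The polynomial `T_n(cosh θ - |x - y_i|² / B)` peaks at `y_i`, where it equals `cosh (n θ) ≥ L`.
-- At the other points its argument lies in `[-1, 1]`, so it is bounded by `1` there. Diagonal
-- dominance makes these `L` polynomials of degree at most `2 n` independent.
open Polynomial.Chebyshev in
theorem HasPolynomialGrowth.card_le_of_separated {ι : Type*} [Fintype ι] {T : Set (ι → ℝ)}
    {C m L n : ℕ} (hT : HasPolynomialGrowth T C m) {B θ : ℝ} (hB : 0 < B)
    (hTB : ∀ x ∈ T, ∀ y ∈ T, ∑ j, (x j - y j) ^ 2 ≤ B) (hθ : 0 ≤ θ) (hθ1 : θ ≤ 1)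
    (y : Fin L → T) (hy : ∀ i j, i ≠ j → B * θ ^ 2 ≤ ∑ k, ((y j).1 k - (y i).1 k) ^ 2)
    (hn : (L : ℝ) ≤ Real.cosh (n * θ)) : L ≤ (C * (2 * n) + 1) ^ m := by
  -- Separation subtracts at least `θ ^ 2` from `cosh θ`, which must bring the argument down to at
  -- most `1`.
  have hcosh : Real.cosh θ ≤ 1 + θ ^ 2 := by
    refine (Real.cosh_le_exp_half_sq θ).trans ?_
    have h1 := Real.exp_bound_div_one_sub_of_interval (x := θ ^ 2 / 2) (by positivity)
      (by nlinarith)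
    refine h1.trans ?_
    rw [div_le_iff₀ (by nlinarith)]
    nlinarith [sq_nonneg θ, mul_nonneg (sq_nonneg θ) (by nlinarith : 0 ≤ 1 - θ ^ 2)]
  let P : Fin L → MvPolynomial ι ℝ := fun i => MvPolynomial.C (Real.cosh θ) -
    MvPolynomial.C B⁻¹ * ∑ k, (MvPolynomial.X k - MvPolynomial.C ((y i).1 k)) ^ 2
  have hPdeg : ∀ i, (P i).totalDegree ≤ 2 := by
    intro i
    refine (MvPolynomial.totalDegree_sub _ _).trans (max_le (by simp) ?_)
    refine (MvPolynomial.totalDegree_mul _ _).trans ?_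
    rw [MvPolynomial.totalDegree_C, zero_add]
    refine MvPolynomial.totalDegree_finsetSum_le fun k _ => ?_
    refine (MvPolynomial.totalDegree_pow _ _).trans ?_
    have := (MvPolynomial.totalDegree_sub (MvPolynomial.X k)
      (MvPolynomial.C ((y i).1 k) : MvPolynomial ι ℝ)).trans (max_le (b := _) (c := 1) (by simp) (by simp))
    omega
  have hPeval : ∀ i (x : ι → ℝ), MvPolynomial.eval x (P i) =
      Real.cosh θ - B⁻¹ * ∑ k, (x k - (y i).1 k) ^ 2 := by
    intro i x
    simp [P]
  have hev : ∀ i (x : ι → ℝ), MvPolynomial.eval x (Polynomial.aeval (P i) (Polynomial.Chebyshev.T ℝ n)) =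
      (Polynomial.Chebyshev.T ℝ n).eval (Real.cosh θ - B⁻¹ * ∑ k, (x k - (y i).1 k) ^ 2) := by
    intro i x
    rw [← hPeval, ← MvPolynomial.coe_aeval_eq_eval, RingHom.coe_coe, ← Polynomial.aeval_algHom_apply,
      Polynomial.coe_aeval_eq_eval]
  refine hT (2 * n) L (fun i => Polynomial.aeval (P i) (Polynomial.Chebyshev.T ℝ n)) ?_ ?_
  · intro i
    refine (MvPolynomial.totalDegree_polynomial_aeval_le _ _).trans ?_
    rw [natDegree_T, Int.natAbs_natCast, mul_comm]
    exact Nat.mul_le_mul_right _ (hPdeg i)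
  · refine linearIndependent_of_diagonally_dominant _ y hn ?_ ?_
    · intro i
      simp only [hev, sub_self]
      simp only [ne_eq, OfNat.ofNat_ne_zero, not_false_eq_true, zero_pow, Finset.sum_const_zero,
        mul_zero, sub_zero, T_real_cosh]
      exact le_abs_self _
    · intro i j hij
      simp only [hev]
      apply abs_eval_T_real_le_one
      have h1 : θ ^ 2 ≤ B⁻¹ * ∑ k, ((y j).1 k - (y i).1 k) ^ 2 := by
        rw [inv_mul_eq_div, le_div_iff₀ hB, mul_comm]
        exact hy i j hij
      have h2 : B⁻¹ * ∑ k, ((y j).1 k - (y i).1 k) ^ 2 ≤ 1 := by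
        rw [inv_mul_eq_div, div_le_one hB]
        exact hTB _ (y j).2 _ (y i).2
      have h3 := Real.one_le_cosh θ
      rw [abs_le]
      constructor <;> linarith

-- A maximal `ε`-separated set is also an `ε`-net, so balls around it cover `T` and keep the
-- `s`-dimensional Hausdorff sums below `2 ^ s * A`.
open Filter Topology MeasureTheory Metric in
theorem dimH_le_of_packingNumber_le {X : Type*} [EMetricSpace X] {T : Set X} {s : NNReal}
    {A : ENNReal} (hA : A ≠ ⊤) (ε : ℕ → NNReal) (hε : Tendsto ε atTop (𝓝 0)) (L : ℕ → ℕ)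
    (hL : ∀ᶠ k in atTop, packingNumber (ε k) T ≤ L k)
    (hLε : ∀ᶠ k in atTop, (L k : ENNReal) * (ε k : ENNReal) ^ (s : ℝ) ≤ A) : dimH T ≤ s := by
  borelize X
  refine dimH_le_of_hausdorffMeasure_ne_top (ne_top_of_le_ne_top
    (b := A * (2 : ENNReal) ^ (s : ℝ)) (by finiteness) ?_)
  have hfin : ∀ k, (maximalSeparatedSet (ε k) T).Finite := by
    intro k
    by_cases h : packingNumber (ε k) T = ⊤
    · simp [maximalSeparatedSet, h]
    · rw [← Set.encard_ne_top_iff, encard_maximalSeparatedSet h]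
      exact h
  let _ : ∀ k, Fintype (maximalSeparatedSet (ε k) T) := fun k => (hfin k).fintype
  have hdiam : ∀ k (i : maximalSeparatedSet (ε k) T),
      ediam (closedEBall (i : X) (ε k)) ≤ 2 * (ε k : ENNReal) := fun k i =>
    ediam_closedEBall_le
  have h0 : Tendsto (fun k => 2 * (ε k : ENNReal)) atTop (𝓝 0) := by
    have := ENNReal.Tendsto.const_mul (a := 2) (ENNReal.tendsto_coe.mpr hε) (Or.inr (by simp))
    simpa using this
  refine (Measure.hausdorffMeasure_le_liminf_sum s T (fun k => 2 * (ε k : ENNReal)) h0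
    (fun k (i : maximalSeparatedSet (ε k) T) => closedEBall (i : X) (ε k))
    (Eventually.of_forall hdiam) ?_).trans ?_
  · filter_upwards [hL] with k hk
    have := isCover_maximalSeparatedSet (ne_top_of_le_ne_top (by simp) hk)
    rw [isCover_iff_subset_iUnion_closedEBall] at this
    simpa [Set.iUnion_subtype] using this
  · refine liminf_le_of_frequently_le' (Eventually.frequently ?_)
    filter_upwards [hL, hLε] with k hk hk'
    have hcard : (Fintype.card (maximalSeparatedSet (ε k) T) : ENNReal) ≤ L k := by
      rw [← encard_maximalSeparatedSet (ne_top_of_le_ne_top (by simp) hk),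
        Set.encard_eq_coe_toFinset_card, Set.toFinset_card] at hk
      exact_mod_cast hk
    calc ∑ i : maximalSeparatedSet (ε k) T, ediam (closedEBall (i : X) (ε k)) ^ (s : ℝ)
        ≤ ∑ i : maximalSeparatedSet (ε k) T, (2 * (ε k : ENNReal)) ^ (s : ℝ) :=
          Finset.sum_le_sum fun i _ => ENNReal.rpow_le_rpow (hdiam k i) s.2
      _ = Fintype.card (maximalSeparatedSet (ε k) T) * (ε k : ENNReal) ^ (s : ℝ) *
          2 ^ (s : ℝ) := by
        rw [Finset.sum_const, nsmul_eq_mul, ENNReal.mul_rpow_of_nonneg _ _ s.coe_nonneg, Finset.card_univ]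
        ring
      _ ≤ A * 2 ^ (s : ℝ) := by
        gcongr
        exact le_trans (by gcongr) hk'

theorem HasPolynomialGrowth.packingNumber_le {ι : Type*} [Fintype ι] {T : Set (ι → ℝ)}
    {C m L n : ℕ} (hT : HasPolynomialGrowth T C m) {b : ℝ} (hb : 1 ≤ b)
    (hTB : ∀ x ∈ T, ∀ y ∈ T, ∑ j, (x j - y j) ^ 2 ≤ b ^ 2) {ε : NNReal} (hε1 : ε ≤ 1)
    (hn : (L : ℝ) ≤ Real.cosh (n * (ε / b))) (hlt : (C * (2 * n) + 1) ^ m < L) :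
    Metric.packingNumber ε T ≤ L := by
  by_contra! hlt'
  simp only [Metric.packingNumber, lt_iSup_iff] at hlt'
  obtain ⟨S, hST, hS, hLS⟩ := hlt'
  obtain ⟨S', hS'S, hS'⟩ := Set.exists_subset_encard_eq hLS.le
  have hfin : S'.Finite := Set.finite_of_encard_eq_coe hS'
  have : Fintype S' := hfin.fintype
  have hcard : Fintype.card S' = L := by
    rw [Set.encard_eq_coe_toFinset_card, Set.toFinset_card] at hS'
    exact_mod_cast hS'
  let φ := (Fintype.equivFinOfCardEq hcard).symm
  have h0b : 0 < b := by linarith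
  refine absurd (hT.card_le_of_separated (B := b ^ 2) (θ := ε / b) (by positivity) hTB
    (by positivity) ((div_le_one h0b).mpr ?_) (fun i => ⟨φ i, hST (hS'S (φ i).2)⟩) ?_ hn) hlt.not_ge
  · exact le_trans (by exact_mod_cast hε1) hb
  · intro i j hij
    have hne : (φ j : ι → ℝ) ≠ φ i := fun h => hij (φ.injective (Subtype.ext h)).symm
    have hsep : (ε : ENNReal) < edist (φ j : ι → ℝ) (φ i) := hS (hS'S (φ j).2) (hS'S (φ i).2) hne
    rw [edist_nndist, ENNReal.coe_lt_coe, ← NNReal.coe_lt_coe, coe_nndist] at hsep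
    -- Separation is in the sup metric; one far coordinate already bounds the sum of squares from
    -- below.
    have : ∃ k, (ε : ℝ) < dist ((φ j : ι → ℝ) k) ((φ i : ι → ℝ) k) := by
      by_contra! hcon
      exact absurd ((dist_pi_le_iff ε.2).mpr hcon) hsep.not_ge
    obtain ⟨k, hk⟩ := this
    rw [div_pow, mul_div_cancel₀ _ (by positivity)]
    calc (ε : ℝ) ^ 2 ≤ (dist ((φ j : ι → ℝ) k) ((φ i : ι → ℝ) k)) ^ 2 := by gcongr
      _ = ((φ j : ι → ℝ) k - (φ i : ι → ℝ) k) ^ 2 := by rw [Real.dist_eq, sq_abs]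
      _ ≤ _ := Finset.single_le_sum (f := fun k => ((φ j : ι → ℝ) k - (φ i : ι → ℝ) k) ^ 2)
        (fun _ _ => sq_nonneg _) (Finset.mem_univ k)

open Filter Topology in
theorem eventually_growth_lt_exp (C m : ℕ) {b s : ℝ} (hb : 1 ≤ b) (hs : (m : ℝ) < s) :
    ∀ᶠ k : ℕ in atTop, ∃ n : ℕ, ((⌈Real.exp (s * k)⌉₊ : ℕ) : ℝ) ≤ Real.cosh (n * (Real.exp (-k) / b)) ∧
      (C * (2 * n) + 1) ^ m < ⌈Real.exp (s * k)⌉₊ := by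
  have hs0 : 0 < s := lt_of_le_of_lt (by positivity) hs
  have hb0 : 0 < b := by linarith
  set A : ℝ := 2 * C * ((2 + s) * b + 1) + 1 with hA
  have hA0 : 0 < A := by positivity
  have hlo := ((isLittleO_pow_exp_pos_mul_atTop m (sub_pos.mpr hs)).comp_tendsto
    tendsto_natCast_atTop_atTop).def (c := (A ^ m)⁻¹ / 2) (by positivity)
  filter_upwards [hlo, eventually_ge_atTop 1] with k hk hk1
  have hk1' : (1 : ℝ) ≤ k := by exact_mod_cast hk1
  have hexp1 : 1 ≤ Real.exp (s * k) := Real.one_le_exp (by positivity)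
  have hceil : (⌈Real.exp (s * k)⌉₊ : ℝ) ≤ 2 * Real.exp (s * k) := by
    have := Nat.ceil_lt_add_one (Real.exp_pos (s * k)).le
    linarith
  have hek : 1 ≤ Real.exp k := Real.one_le_exp (by positivity)
  -- With this `n`, `n θ ≥ (2 + s) k ≥ 2 + s k`, so `cosh (n θ) ≥ e ^ (2 + s k) / 2 ≥ 2 e ^ (s k)`.
  -- Yet `n` is only `O(k e ^ k)`, and `(k e ^ k) ^ m = o(e ^ (s k))` because `m < s`.
  refine ⟨⌈(2 + s) * k * b * Real.exp k⌉₊, ?_, ?_⟩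
  · refine hceil.trans ?_
    have h1 : (2 + s) * k ≤ ⌈(2 + s) * k * b * Real.exp k⌉₊ * (Real.exp (-k) / b) := by
      calc (2 + s) * k = ((2 + s) * k * b * Real.exp k) * (Real.exp (-k) / b) := by
            rw [Real.exp_neg]
            field_simp
        _ ≤ _ := by gcongr; exact Nat.le_ceil _
    have h2 : Real.exp (2 + s * k) / 2 ≤
        Real.cosh (⌈(2 + s) * k * b * Real.exp k⌉₊ * (Real.exp (-k) / b)) := by
      rw [Real.cosh_eq]
      have : Real.exp (2 + s * k) ≤ Real.exp (⌈(2 + s) * k * b * Real.exp k⌉₊ * (Real.exp (-k) / b)) :=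
        Real.exp_le_exp.mpr (le_trans (by nlinarith) h1)
      have := Real.exp_pos (-(⌈(2 + s) * k * b * Real.exp k⌉₊ * (Real.exp (-k) / b)))
      linarith
    refine le_trans ?_ h2
    rw [Real.exp_add]
    have : (4 : ℝ) ≤ Real.exp 2 := by
      have h := Real.exp_one_gt_d9
      have : Real.exp 2 = Real.exp 1 * Real.exp 1 := by rw [← Real.exp_add]; norm_num
      nlinarith
    nlinarith
  · have hn : (⌈(2 + s) * k * b * Real.exp k⌉₊ : ℝ) ≤ ((2 + s) * b + 1) * (k * Real.exp k) := by
      have := Nat.ceil_lt_add_one (show 0 ≤ (2 + s) * k * b * Real.exp k by positivity)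
      have h1 : 1 ≤ k * Real.exp k := one_le_mul_of_one_le_of_one_le hk1' hek
      nlinarith
    have hn2 : (C * (2 * ⌈(2 + s) * k * b * Real.exp k⌉₊) + 1 : ℝ) ≤ A * (k * Real.exp k) := by
      have h1 : 1 ≤ k * Real.exp k := one_le_mul_of_one_le_of_one_le hk1' hek
      have : (C : ℝ) * (2 * ⌈(2 + s) * k * b * Real.exp k⌉₊) ≤
        C * (2 * (((2 + s) * b + 1) * (k * Real.exp k))) := by gcongr
      rw [hA]
      linarith
    have hlast : (A * (k * Real.exp k)) ^ m < Real.exp (s * k) := by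
      simp only [Function.comp_apply, Real.norm_eq_abs, Real.abs_exp] at hk
      rw [abs_of_nonneg (by positivity)] at hk
      calc (A * (k * Real.exp k)) ^ m = A ^ m * k ^ m * Real.exp (m * k) := by
            rw [mul_pow, mul_pow, ← Real.exp_nat_mul]; ring
        _ ≤ A ^ m * ((A ^ m)⁻¹ / 2 * Real.exp ((s - m) * k)) * Real.exp (m * k) := by gcongr
        _ = Real.exp (s * k) / 2 := by
          have : Real.exp (s * k) = Real.exp ((s - m) * k) * Real.exp (m * k) := by
            rw [← Real.exp_add]; ring_nf
          rw [this]
          field_simp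
        _ < Real.exp (s * k) := by linarith
    have : ((C * (2 * ⌈(2 + s) * k * b * Real.exp k⌉₊) + 1 : ℝ)) ^ m < ⌈Real.exp (s * k)⌉₊ :=
      lt_of_le_of_lt (pow_le_pow_left₀ (by positivity) hn2 m) (hlast.trans_le (Nat.le_ceil _))
    exact_mod_cast this

open Filter Topology Bornology in
theorem HasPolynomialGrowth.dimH_le_of_isBounded {ι : Type*} [Fintype ι] {T : Set (ι → ℝ)}
    {C m : ℕ} (hT : HasPolynomialGrowth T C m) (hbdd : IsBounded T) : dimH T ≤ m := by
  obtain ⟨R, hR⟩ := Metric.isBounded_iff.mp hbdd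
  obtain ⟨b, hb, hTB⟩ : ∃ b : ℝ, 1 ≤ b ∧ ∀ x ∈ T, ∀ y ∈ T, ∑ j, (x j - y j) ^ 2 ≤ b ^ 2 := by
    refine ⟨1 + Fintype.card ι * R ^ 2, by nlinarith [show 0 ≤ (Fintype.card ι : ℝ) * R ^ 2 by positivity], fun x hx y hy => ?_⟩
    have h1 : ∑ j, (x j - y j) ^ 2 ≤ ∑ _j : ι, R ^ 2 := by
      refine Finset.sum_le_sum fun j _ => ?_
      rw [← sq_abs, ← Real.dist_eq]
      have := (dist_le_pi_dist x y j).trans (hR hx hy)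
      gcongr
    rw [Finset.sum_const, nsmul_eq_mul, Finset.card_univ] at h1
    nlinarith [show 0 ≤ (Fintype.card ι : ℝ) * R ^ 2 by positivity]
  refine le_of_forall_gt_imp_ge_of_dense fun s hs => ?_
  induction s using ENNReal.recTopCoe with
  | top => exact le_top
  | coe s =>
    have hs' : (m : ℝ) < s := by exact_mod_cast hs
    have hcoe : ∀ k : ℕ, ((Real.exp (-k)).toNNReal : ℝ) = Real.exp (-k) := fun k =>
      Real.coe_toNNReal _ (Real.exp_pos _).le
    refine dimH_le_of_packingNumber_le (A := 2) (by simp)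
      (fun k : ℕ => (Real.exp (-k)).toNNReal) ?_
      (fun k : ℕ => ⌈Real.exp (s * k)⌉₊) ?_ ?_
    · rw [← NNReal.tendsto_coe]
      simp only [hcoe]
      exact Real.tendsto_exp_neg_atTop_nhds_zero.comp tendsto_natCast_atTop_atTop
    · filter_upwards [eventually_growth_lt_exp C m hb hs'] with k ⟨n, hn, hn'⟩
      refine hT.packingNumber_le (n := n) hb hTB ?_ (by rwa [hcoe]) hn'
      rw [← NNReal.coe_le_coe, hcoe]
      simp
    · refine Eventually.of_forall fun k => ?_
      have h1 : (⌈Real.exp (s * k)⌉₊ : ℝ) * Real.exp (-k) ^ (s : ℝ) ≤ 2 := by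
        have := Nat.ceil_lt_add_one (Real.exp_pos (s * k)).le
        have hexp1 : 1 ≤ Real.exp (s * k) := Real.one_le_exp (by positivity)
        rw [← Real.exp_mul]
        calc (⌈Real.exp (s * k)⌉₊ : ℝ) * Real.exp (-k * s) ≤
            2 * Real.exp (s * k) * Real.exp (-k * s) := by gcongr; linarith
          _ = 2 := by
            rw [mul_assoc, ← Real.exp_add]
            ring_nf
            simp
      rw [← ENNReal.coe_rpow_of_nonneg _ s.coe_nonneg]
      have h2 : ((⌈Real.exp (s * k)⌉₊ : NNReal) * (Real.exp (-k)).toNNReal ^ (s : ℝ)) ≤ 2 := by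
        rw [← NNReal.coe_le_coe]
        push_cast
        rw [hcoe]
        exact h1
      exact_mod_cast h2

theorem HasPolynomialGrowth.mono {ι : Type*} {S T : Set (ι → ℝ)} {C m : ℕ}
    (hT : HasPolynomialGrowth T C m) (hST : S ⊆ T) : HasPolynomialGrowth S C m := by
  intro D L Q hQ hli
  exact hT D L Q hQ (LinearIndependent.of_comp (LinearMap.funLeft ℝ ℝ (Set.inclusion hST)) hli)

theorem HasPolynomialGrowth.dimH_le {ι : Type*} [Fintype ι] {T : Set (ι → ℝ)}
    {C m : ℕ} (hT : HasPolynomialGrowth T C m) : dimH T ≤ m := by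
  have h : T = ⋃ k : ℕ, T ∩ Metric.closedBall 0 k := by
    rw [← Set.inter_iUnion, Metric.iUnion_closedBall_nat, Set.inter_univ]
  rw [h, dimH_iUnion]
  exact iSup_le fun k => (hT.mono Set.inter_subset_left).dimH_le_of_isBounded
    (Metric.isBounded_closedBall.subset Set.inter_subset_right)

/-! ### Jets and restriction to coordinate subspaces -/

namespace MvPolynomial

section

variable {σ K : Type*} [Field K]

theorem pderiv_pderiv_comm (s t : σ) (p : MvPolynomial σ K) :
    pderiv s (pderiv t p) = pderiv t (pderiv s p) := by
  classical
  ext m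
  simp only [coeff_pderiv, Finsupp.add_apply, Finsupp.single_apply]
  rcases eq_or_ne s t with rfl | h
  · rfl
  · simp only [h, h.symm, if_false, add_zero, add_right_comm m (Finsupp.single s 1)]
    ring

theorem totalDegree_pderiv_le_of_le {s : σ} {n : ℕ} {p : MvPolynomial σ K}
    (hp : p.totalDegree ≤ n + 1) : (pderiv s p).totalDegree ≤ n := by
  classical
  refine Finset.sup_le fun b hb => ?_
  rw [mem_support_iff, coeff_pderiv] at hb
  have h1 := le_totalDegree (mem_support_iff.mpr (left_ne_zero_of_mul hb))
  rw [Finsupp.sum_add_index' (by simp) (by simp), Finsupp.sum_single_index rfl] at h1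
  omega

theorem totalDegree_aeval_le {τ : Type*} {e : ℕ} (G : σ → MvPolynomial τ K)
    (hG : ∀ s, (G s).totalDegree ≤ e) (Q : MvPolynomial σ K) :
    (aeval G Q).totalDegree ≤ Q.totalDegree * e := by
  rw [aeval_def, eval₂_eq]
  refine totalDegree_finsetSum_le fun d hd => ?_
  refine (totalDegree_mul _ _).trans ?_
  rw [algebraMap_eq, totalDegree_C, zero_add]
  refine (totalDegree_finsetProd _ _).trans ?_
  calc ∑ i ∈ d.support, (G i ^ d i).totalDegree ≤ ∑ i ∈ d.support, d i * e :=
        Finset.sum_le_sum fun i _ => (totalDegree_pow _ _).trans (Nat.mul_le_mul_left _ (hG i))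
    _ = (∑ i ∈ d.support, d i) * e := by rw [Finset.sum_mul]
    _ ≤ Q.totalDegree * e := Nat.mul_le_mul_right _ (le_totalDegree hd)

/-- The polynomials all of whose partial derivatives of order at most `n` lie in `B`. -/
def jetIdeal (B : Ideal (MvPolynomial σ K)) : ℕ → Ideal (MvPolynomial σ K)
  | 0 => B
  | n + 1 =>
    { carrier := {h | h ∈ jetIdeal B n ∧ ∀ s, pderiv s h ∈ jetIdeal B n}
      add_mem' := fun ha hb => ⟨add_mem ha.1 hb.1, fun s => by
        rw [map_add]; exact add_mem (ha.2 s) (hb.2 s)⟩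
      zero_mem' := ⟨zero_mem _, fun s => by rw [map_zero]; exact zero_mem _⟩
      smul_mem' := fun a h hh => ⟨Ideal.mul_mem_left _ a hh.1, fun s => by
        rw [smul_eq_mul, pderiv_mul]
        exact add_mem (Ideal.mul_mem_left _ _ hh.1) (Ideal.mul_mem_left _ _ (hh.2 s))⟩ }

theorem mem_jetIdeal_succ {B : Ideal (MvPolynomial σ K)} {n : ℕ} {h : MvPolynomial σ K} :
    h ∈ jetIdeal B (n + 1) ↔ h ∈ jetIdeal B n ∧ ∀ s, pderiv s h ∈ jetIdeal B n := Iff.rfl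

theorem pderiv_mem_jetIdeal {B : Ideal (MvPolynomial σ K)} {s : σ}
    (hB : ∀ h ∈ B, pderiv s h ∈ B) (n : ℕ) :
    ∀ h ∈ jetIdeal B n, pderiv s h ∈ jetIdeal B n := by
  induction n with
  | zero => exact hB
  | succ n ih =>
    intro h hh
    rw [mem_jetIdeal_succ] at hh ⊢
    refine ⟨ih _ hh.1, fun t => ?_⟩
    rw [pderiv_pderiv_comm]
    exact ih _ (hh.2 t)

/-- In `∂(δ h) = ∂δ * h + δ * ∂h` the first term lies in the lower jet ideal by induction, so `δ`
can be cancelled from the second. -/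
theorem mem_jetIdeal_of_mul_mem {B : Ideal (MvPolynomial σ K)} (hB : B.IsPrime)
    {δ : MvPolynomial σ K} (hδ : δ ∉ B) (n : ℕ) :
    ∀ h, δ * h ∈ jetIdeal B n → h ∈ jetIdeal B n := by
  induction n with
  | zero => exact fun h hh => (hB.mem_or_mem hh).resolve_left hδ
  | succ n ih =>
    intro h hh
    rw [mem_jetIdeal_succ] at hh ⊢
    have h1 := ih h hh.1
    refine ⟨h1, fun s => ih _ ?_⟩
    have h2 := hh.2 s
    rw [pderiv_mul] at h2
    exact (Ideal.add_mem_iff_right _ (Ideal.mul_mem_left _ _ h1)).mp h2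

/-- Differentiating lowers the degree, so by induction all partials vanish and `g` is constant in
characteristic zero; a proper ideal contains no nonzero constant. -/
theorem eq_zero_of_mem_jetIdeal [CharZero K] {B : Ideal (MvPolynomial σ K)} (hB : B ≠ ⊤) (n : ℕ) :
    ∀ g ∈ jetIdeal B n, g.totalDegree ≤ n → g = 0 := by
  have hconst : ∀ n, ∀ g ∈ jetIdeal B n, g.totalDegree = 0 → g = 0 := by
    intro n g hg hdeg
    have hgB : g ∈ B := by
      induction n with
      | zero => exact hg
      | succ n ih => exact ih hg.1
    rw [totalDegree_eq_zero_iff_eq_C.mp hdeg] at hgB ⊢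
    by_contra hne
    refine hB (Ideal.eq_top_of_isUnit_mem _ hgB ?_)
    exact (isUnit_iff_ne_zero.mpr fun h => hne (by rw [h, C_0])).map C
  induction n with
  | zero => exact fun g hg hdeg => hconst 0 g hg (Nat.le_zero.mp hdeg)
  | succ n ih =>
    intro g hg hdeg
    refine hconst _ g hg ?_
    have hd : ∀ s, pderiv s g = 0 := fun s => ih _ (hg.2 s) (totalDegree_pderiv_le_of_le hdeg)
    refine Nat.le_zero.mp (Finset.sup_le fun b hb => ?_)
    by_cases hb0 : b = 0
    · simp [hb0]
    · obtain ⟨s, hs⟩ := Finsupp.ne_iff.mp hb0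
      have h1 := congrArg (coeff (b - Finsupp.single s 1)) (hd s)
      rw [coeff_pderiv, coeff_zero, tsub_add_cancel_of_le
        (Finsupp.single_le_iff.mpr (Nat.one_le_iff_ne_zero.mpr hs))] at h1
      rcases mul_eq_zero.mp h1 with h2 | h2
      · exact absurd h2 (mem_support_iff.mp hb)
      · exact absurd h2 (Nat.cast_add_one_ne_zero _)

/-- Think of `B` as the polynomials vanishing on a coordinate subspace with directions `c i`.
Tangential derivatives preserve vanishing to any order, and `hid` expresses every derivative of `g`
through tangential ones, up to the cancellable `δ`. So `g` vanishes to infinite order. -/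
theorem eq_zero_of_mem_of_mul_pderiv_eq [CharZero K] {κ : Type*} [Fintype κ]
    {B : Ideal (MvPolynomial σ K)} (hB : B.IsPrime) {c : κ → σ}
    (hBc : ∀ i, ∀ h ∈ B, pderiv (c i) h ∈ B) {δ : MvPolynomial σ K} (hδ : δ ∉ B)
    {b : σ → κ → MvPolynomial σ K} {g : MvPolynomial σ K} (hg : g ∈ B)
    (hid : ∀ s, δ * pderiv s g = ∑ i, b s i * pderiv (c i) g) : g = 0 := by
  have hmem : ∀ n, g ∈ jetIdeal B n := by
    intro n
    induction n with
    | zero => exact hg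
    | succ n ih =>
      refine mem_jetIdeal_succ.mpr ⟨ih, fun s => mem_jetIdeal_of_mul_mem hB hδ n _ ?_⟩
      rw [hid]
      exact sum_mem fun i _ => Ideal.mul_mem_left _ _ (pderiv_mem_jetIdeal (hBc i) n g ih)
  exact eq_zero_of_mem_jetIdeal hB.ne_top _ g (hmem _) le_rfl

open Classical in
/-- Restriction of polynomials to the affine coordinate subspace through `x` in the
directions `c i`. -/
noncomputable def restrictToSubspace {κ : Type*} (x : σ → K) (c : κ → σ) :
    MvPolynomial σ K →ₐ[K] MvPolynomial κ K :=
  aeval fun s => if h : ∃ i, c i = s then X h.choose else C (x s)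

section restrictToSubspace

variable {κ : Type*} (x : σ → K) {c : κ → σ}

theorem eval_restrictToSubspace (c : κ → σ) (p : MvPolynomial σ K) :
    eval (fun i => x (c i)) (restrictToSubspace x c p) = eval x p := by
  classical
  rw [restrictToSubspace]
  induction p using MvPolynomial.induction_on with
  | C a => simp
  | add p q hp hq => simp only [map_add, hp, hq]
  | mul_X p s hp =>
    rw [map_mul, map_mul, hp, map_mul, aeval_X, eval_X]
    split_ifs with h
    · rw [eval_X, h.choose_spec]
    · rw [eval_C]

theorem pderiv_restrictToSubspace (hc : Function.Injective c) (i : κ) (p : MvPolynomial σ K) :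
    pderiv i (restrictToSubspace x c p) = restrictToSubspace x c (pderiv (c i) p) := by
  classical
  have hX : ∀ s, pderiv i (restrictToSubspace x c (X s)) =
      restrictToSubspace x c (pderiv (c i) (X s)) := by
    intro s
    rw [restrictToSubspace, aeval_X, pderiv_X]
    split_ifs with h
    · rw [pderiv_X]
      by_cases hi : h.choose = i
      · have : s = c i := by rw [← h.choose_spec, hi]
        subst this
        simp [hi]
      · have : s ≠ c i := fun hs => hi (hc (h.choose_spec.trans hs))
        simp [Pi.single_eq_of_ne hi, Pi.single_eq_of_ne this]
    · have : s ≠ c i := fun hs => h ⟨i, hs.symm⟩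
      simp [Pi.single_eq_of_ne this]
  induction p using MvPolynomial.induction_on with
  | C a => simp [restrictToSubspace]
  | add p q hp hq => simp only [map_add, hp, hq]
  | mul_X p s hp => simp only [map_mul, map_add, pderiv_mul, hp, hX]

theorem totalDegree_restrictToSubspace_le (p : MvPolynomial σ K) :
    (restrictToSubspace x c p).totalDegree ≤ p.totalDegree := by
  classical
  rw [restrictToSubspace]
  refine (totalDegree_aeval_le (e := 1) _ (fun s => ?_) p).trans_eq (mul_one _)
  split_ifs
  · exact (totalDegree_X _).le
  · simp

end restrictToSubspace

theorem finrank_restrictDegree_le (m N : ℕ) :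
    Module.finrank K (restrictDegree (Fin m) K N) ≤ (N + 1) ^ m := by
  have b := basisRestrictSupport K {f : Fin m →₀ ℕ | ∀ a, f a ≤ N}
  let φ : {f : Fin m →₀ ℕ | ∀ a, f a ≤ N} → (Fin m → Fin (N + 1)) :=
    fun f a => ⟨f.1 a, Nat.lt_succ_of_le (f.2 a)⟩
  have hφ : Function.Injective φ := by
    intro f g h
    ext a
    exact congrArg Fin.val (congrFun h a)
  have h1 : Module.finrank K (restrictDegree (Fin m) K N) =
      Nat.card {f : Fin m →₀ ℕ | ∀ a, f a ≤ N} := Module.finrank_eq_nat_card_basis b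
  rw [h1]
  refine (Nat.card_le_card_of_injective φ hφ).trans_eq ?_
  simp

end

end MvPolynomial

/-! ### Maximal minors over a commutative ring -/

namespace Matrix

/-- The empty minor is `1`, and a minor with more rows than `ι` has elements repeats a row. This
replaces rank over the fraction field and avoids denominators. -/
theorem exists_maximal_minor {ι σ R : Type*} [Finite ι] [CommRing R] [Nontrivial R]
    (J : Matrix ι σ R) : ∃ (m : ℕ) (r : Fin m → ι) (c : Fin m → σ), (J.submatrix r c).det ≠ 0 ∧
      ∀ (r' : Fin (m + 1) → ι) (c' : Fin (m + 1) → σ), (J.submatrix r' c').det = 0 := by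
  by_contra! hcon
  have h : ∀ m : ℕ, ∃ (r : Fin m → ι) (c : Fin m → σ), (J.submatrix r c).det ≠ 0 := by
    intro m
    induction m with
    | zero => exact ⟨Fin.elim0, Fin.elim0, by simp⟩
    | succ m ih =>
      obtain ⟨r, c, hrc⟩ := ih
      exact hcon m r c hrc
  obtain ⟨r, c, hrc⟩ := h (Nat.card ι + 1)
  have hr : ¬ Function.Injective r := fun hr => by
    have := Nat.card_le_card_of_injective r hr
    simp at this
  simp only [Function.Injective, not_forall] at hr
  obtain ⟨i, j, hij, hne⟩ := hr
  exact hrc (det_zero_of_row_eq hne (by ext k; simp [hij]))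

/-- Expand the vanishing minor bordered by row `e` and column `s` along row `e`; the cofactors do
not depend on `e`. -/
theorem exists_mul_eq_sum_of_maximal_minor {ι σ R : Type*} [CommRing R] (J : Matrix ι σ R) {m : ℕ}
    (r : Fin m → ι) (c : Fin m → σ)
    (h : ∀ (r' : Fin (m + 1) → ι) (c' : Fin (m + 1) → σ), (J.submatrix r' c').det = 0) (s : σ) :
    ∃ b : Fin m → R, ∀ e, (J.submatrix r c).det * J e s = ∑ i, b i * J e (c i) := by
  refine ⟨fun i => (-1) ^ (i : ℕ) *
    (J.submatrix r ((Fin.cons s c : Fin (m + 1) → σ) ∘ i.succ.succAbove)).det, fun e => ?_⟩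
  have h1 := h (Fin.cons e r) (Fin.cons s c)
  rw [det_succ_row_zero, Fin.sum_univ_succ] at h1
  simp only [submatrix_submatrix, submatrix_apply, Fin.cons_zero, Fin.cons_succ, Fin.val_zero,
    pow_zero, one_mul, Fin.val_succ, pow_succ] at h1
  have hr : (Fin.cons e r : Fin (m + 1) → ι) ∘ Fin.succ = r := rfl
  have hc : (Fin.cons s c : Fin (m + 1) → σ) ∘ Fin.succAbove 0 = c := by
    rw [Fin.succAbove_zero]; rfl
  rw [hr, hc] at h1
  rw [mul_comm, eq_neg_of_add_eq_zero_left h1, ← Finset.sum_neg_distrib]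
  exact Finset.sum_congr rfl fun i _ => by ring

end Matrix

theorem Derivation.sum_apply {R A M κ : Type*} [CommSemiring R] [CommSemiring A] [AddCommMonoid M]
    [Algebra R A] [Module A M] [Module R M] (s : Finset κ) (D : κ → Derivation R A M) (a : A) :
    (∑ i ∈ s, D i) a = ∑ i ∈ s, D i a := by
  classical
  induction s using Finset.induction_on with
  | empty => simp
  | insert i s hi ih => rw [Finset.sum_insert hi, Finset.sum_insert hi, Derivation.add_apply, ih]

/-! ### Growth on polynomial images -/

open MvPolynomial in
theorem HasPolynomialGrowth.range_eval {ι σ : Type*} [Finite ι] (F : ι → MvPolynomial σ ℝ)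
    {m : ℕ} (r : Fin m → ι) (c : Fin m → σ)
    (hrc : ((Matrix.of fun e s => pderiv s (F e)).submatrix r c).det ≠ 0)
    (hmax : ∀ (r' : Fin (m + 1) → ι) (c' : Fin (m + 1) → σ),
      ((Matrix.of fun e s => pderiv s (F e)).submatrix r' c').det = 0) :
    ∃ C, HasPolynomialGrowth (Set.range fun (x : σ → ℝ) e => eval x (F e)) C m := by
  have := Fintype.ofFinite ι
  set J : Matrix ι σ (MvPolynomial σ ℝ) := Matrix.of fun e s => pderiv s (F e) with hJ
  set δ := (J.submatrix r c).det with hδ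
  -- The slice passes through a point where `δ` is nonzero, so `δ` does not restrict to zero.
  obtain ⟨x, hx⟩ : ∃ x, eval x δ ≠ 0 := by
    by_contra! h
    exact hrc (MvPolynomial.funext fun x => by rw [h, map_zero])
  have hc : Function.Injective c := by
    intro i j hij
    by_contra hne
    exact hrc (Matrix.det_zero_of_column_eq hne fun k => by simp [hij])
  choose b hb using fun s => J.exists_mul_eq_sum_of_maximal_minor r c hmax s
  -- Both sides are derivations in `g`, so agreement on the generators `F e` suffices.
  have hadj : ∀ g ∈ Algebra.adjoin ℝ (Set.range F), ∀ s,
      δ * pderiv s g = ∑ i, b s i * pderiv (c i) g := by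
    intro g hg s
    have hD := Derivation.eqOn_adjoin (D1 := δ • pderiv (R := ℝ) s)
      (D2 := ∑ i, b s i • pderiv (R := ℝ) (c i)) (s := Set.range F) (by
        rintro _ ⟨e, rfl⟩
        simpa [Derivation.sum_apply, hJ] using hb s e) hg
    simpa [Derivation.sum_apply] using hD
  have hzero : ∀ g ∈ Algebra.adjoin ℝ (Set.range F), restrictToSubspace x c g = 0 → g = 0 := by
    intro g hg h0
    refine eq_zero_of_mem_of_mul_pderiv_eq
      (B := RingHom.ker (restrictToSubspace x c)) (RingHom.ker_isPrime _) (c := c) ?_ (δ := δ) ?_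
      h0 (hadj g hg)
    · intro i h hh
      rw [RingHom.mem_ker] at hh ⊢
      rw [← pderiv_restrictToSubspace x hc, hh, map_zero]
    · intro hmem
      rw [RingHom.mem_ker] at hmem
      apply hx
      rw [← eval_restrictToSubspace x c, hmem, map_zero]
  refine ⟨Finset.univ.sup fun e => (F e).totalDegree, fun D L Q hQ hli => ?_⟩
  set E := Finset.univ.sup fun e => (F e).totalDegree with hE
  have hg : ∀ i, restrictToSubspace x c (aeval F (Q i)) ∈ restrictDegree (Fin m) ℝ (E * D) := by
    intro i
    refine restrictTotalDegree_le_restrictDegree (R := ℝ) (σ := Fin m) _ ((mem_restrictTotalDegree _ _ _).mpr ?_)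
    refine (totalDegree_restrictToSubspace_le x _).trans ((totalDegree_aeval_le (e := E) F
      (fun e => Finset.le_sup (f := fun e => (F e).totalDegree) (Finset.mem_univ e)) _).trans ?_)
    rw [mul_comm]
    exact Nat.mul_le_mul_left _ (hQ i)
  have hli' : LinearIndependent ℝ
      (fun i => (⟨_, hg i⟩ : restrictDegree (Fin m) ℝ (E * D))) := by
    rw [Fintype.linearIndependent_iff] at hli ⊢
    intro a ha
    refine hli a ?_
    have h1 : restrictToSubspace x c (aeval F (∑ i, a i • Q i)) = 0 := by
      have := congrArg Subtype.val ha
      simpa using this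
    have h2 : aeval F (∑ i, a i • Q i) = 0 :=
      hzero _ (by rw [Algebra.adjoin_range_eq_range_aeval]; exact ⟨_, rfl⟩) h1
    ext ⟨_, y, rfl⟩
    have h3 := congrArg (eval y) h2
    have h4 : ∀ q : MvPolynomial ι ℝ, eval y (aeval F q) = eval (fun e => eval y (F e)) q := by
      intro q
      induction q using MvPolynomial.induction_on with
      | C a => simp
      | add p q hp hq => simp only [map_add, hp, hq]
      | mul_X p s hp => simp only [map_mul, hp, aeval_X, eval_X]
    rw [h4] at h3
    simpa [smul_eval] using h3
  calc L = Fintype.card (Fin L) := (Fintype.card_fin L).symm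
    _ ≤ Module.finrank ℝ (restrictDegree (Fin m) ℝ (E * D)) := hli'.fintype_card_le_finrank
    _ ≤ _ := finrank_restrictDegree_le _ _

theorem LinearIndependent.of_eq_smul {ι K M : Type*} [Field K] [AddCommGroup M] [Module K M]
    {v w : ι → M} (c : ι → K) (h : ∀ i, v i = c i • w i) (hv : LinearIndependent K v) :
    LinearIndependent K w := by
  have hc : ∀ i, c i ≠ 0 := fun i hi => hv.ne_zero i (by rw [h, hi, zero_smul])
  have hw : w = (fun i => (Units.mk0 (c i) (hc i))⁻¹) • v := by
    ext i
    simp only [Pi.smul_apply', h i]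
    rw [Units.smul_def, smul_smul]
    simp [hc i]
  rw [hw]
  exact hv.units_smul _

theorem MvPolynomial.hasFDerivAt_eval {σ : Type*} [Fintype σ] (P : MvPolynomial σ ℝ) (x : σ → ℝ) :
    HasFDerivAt (fun x : σ → ℝ => MvPolynomial.eval x P)
      (∑ s, MvPolynomial.eval x (MvPolynomial.pderiv s P) •
        ContinuousLinearMap.proj (R := ℝ) (φ := fun _ : σ => ℝ) s) x := by
  classical
  induction P using MvPolynomial.induction_on with
  | C a => simpa using hasFDerivAt_const a x
  | add p q hp hq =>
    simp only [map_add, add_smul, Finset.sum_add_distrib]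
    exact hp.add hq
  | mul_X p t hp =>
    have h1 : HasFDerivAt (fun x : σ → ℝ => x t)
      (ContinuousLinearMap.proj (R := ℝ) (φ := fun _ : σ => ℝ) t) x := hasFDerivAt_apply t x
    simp only [map_mul, MvPolynomial.eval_X]
    refine (hp.mul h1).congr_fderiv ?_
    ext v
    simp [MvPolynomial.pderiv_X, Pi.single_apply, add_mul,
      Finset.sum_add_distrib, Finset.mul_sum, apply_ite]
    exact Finset.sum_congr rfl fun _ _ => by ring

theorem MvPolynomial.exists_mem_eval_ne_zero_of_isOpen {σ : Type*} [Fintype σ]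
    {P : MvPolynomial σ ℝ} (hP : P ≠ 0) {U : Set (σ → ℝ)} (hU : IsOpen U) (hne : U.Nonempty) :
    ∃ x ∈ U, MvPolynomial.eval x P ≠ 0 := by
  obtain ⟨g, hg⟩ := hne
  obtain ⟨ε, hε, hball⟩ := Metric.isOpen_iff.mp hU g hg
  by_contra! h
  refine hP (MvPolynomial.funext_set (fun s => Metric.ball (g s) ε) (fun s => ?_) fun x hx => ?_)
  · rw [Real.ball_eq_Ioo]
    exact Set.Ioo_infinite (by linarith)
  · rw [map_zero]
    exact h x (hball (by rwa [ball_pi _ hε]))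

theorem contDiffAt_abs_pow {p : ℕ} {t : ℝ} (h : 2 ≤ p ∨ t ≠ 0) :
    ContDiffAt ℝ 1 (fun t : ℝ => |t| ^ p) t := by
  rcases h with hp | ht
  · have := contDiff_norm_rpow (E := ℝ) (p := p) (by exact_mod_cast hp)
    simpa [Real.norm_eq_abs, Real.rpow_natCast] using this.contDiffAt
  · exact (contDiffAt_abs ht).pow p

/-! ### Differentiability of the norm and the lower bound -/

namespace LpRigidity

section

variable {p d : ℕ}

theorem lpNorm_eq (hp : 1 ≤ p) (x : Fin d → ℝ) :
    lpNorm p x = (∑ i, |x i| ^ p) ^ (1 / (p : ℝ)) := by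
  have h : 0 < (p : ℝ≥0∞).toReal := by simpa using Nat.lt_of_lt_of_le one_pos hp
  simp [lpNorm, PiLp.norm_eq_sum h, Real.rpow_natCast]

theorem lpNorm_pow (hp : 1 ≤ p) (x : Fin d → ℝ) : lpNorm p x ^ p = ∑ i, |x i| ^ p := by
  rw [lpNorm_eq hp, one_div, Real.rpow_inv_natCast_pow (by positivity) (by omega)]

theorem lpNorm_nonneg (hp : 1 ≤ p) (x : Fin d → ℝ) : 0 ≤ lpNorm p x := by
  rw [lpNorm_eq hp]
  positivity

theorem differentiableAt_lpNorm (hp : 1 ≤ p) {x : Fin d → ℝ} (hx : ∀ i, x i ≠ 0) :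
    DifferentiableAt ℝ (lpNorm p (d := d)) x := by
  rcases isEmpty_or_nonempty (Fin d) with h | ⟨⟨j⟩⟩
  · exact (hasFDerivAt_of_subsingleton _ _).differentiableAt
  · have h1 : lpNorm p (d := d) = fun x => (∑ i, |x i| ^ p) ^ (1 / (p : ℝ)) :=
      funext fun x => lpNorm_eq hp x
    rw [h1]
    refine DifferentiableAt.rpow_const ?_ (Or.inl ?_)
    · refine DifferentiableAt.fun_sum fun i _ => ?_
      exact DifferentiableAt.comp (g := fun t : ℝ => |t| ^ p) x ((contDiffAt_abs_pow (Or.inr (hx i))).differentiableAt one_ne_zero)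
        (differentiableAt_apply i x)
    · refine ne_of_gt (Finset.sum_pos (fun i _ => ?_) ⟨j, Finset.mem_univ _⟩)
      have := hx i
      positivity

/-- Along the `i`-th coordinate line the norm is `|t|` plus a constant. For `p = 1` this is what
makes edge lengths `C^1` at well-positioned frameworks. -/
theorem ne_zero_of_differentiableAt_lpNorm_one {x : Fin d → ℝ}
    (hx : DifferentiableAt ℝ (lpNorm 1 (d := d)) x) (i : Fin d) : x i ≠ 0 := by
  intro h0
  have h1 : ∀ t, lpNorm 1 (Function.update x i t) =
      |t| + ∑ j ∈ Finset.univ.erase i, |x j| := by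
    intro t
    rw [← pow_one (lpNorm 1 _), lpNorm_pow le_rfl, ← Finset.add_sum_erase _ _ (Finset.mem_univ i)]
    simp only [Function.update_self, pow_one]
    congr 1
    exact Finset.sum_congr rfl fun j hj => by
      rw [Function.update_of_ne (Finset.ne_of_mem_erase hj)]
  have h2 : DifferentiableAt ℝ (fun t => lpNorm 1 (Function.update x i t)) 0 := by
    refine DifferentiableAt.comp (g := lpNorm 1) 0 ?_ (hasFDerivAt_update x 0).differentiableAt
    rwa [← h0, Function.update_eq_self]
  simp only [h1] at h2
  exact not_differentiableAt_abs_zero (by simpa using h2)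

/-- On a coordinate axis the norm is `|t|`. The index `i` is essential: for `d = 0` the norm is
differentiable at the origin. -/
theorem ne_zero_of_differentiableAt_lpNorm (hp : 1 ≤ p) {x : Fin d → ℝ}
    (hx : DifferentiableAt ℝ (lpNorm p (d := d)) x) (i : Fin d) : x ≠ 0 := by
  rintro rfl
  have h1 : ∀ t, lpNorm p (Function.update (0 : Fin d → ℝ) i t) = |t| := by
    intro t
    refine (pow_left_inj₀ (lpNorm_nonneg hp _) (abs_nonneg t) (by omega : p ≠ 0)).mp ?_
    rw [lpNorm_pow hp, Finset.sum_eq_single i]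
    · simp
    · intro j _ hj
      rw [Function.update_of_ne hj]
      simp; omega
    · simp
  have h2 : DifferentiableAt ℝ (fun t => lpNorm p (Function.update (0 : Fin d → ℝ) i t)) 0 := by
    refine DifferentiableAt.comp (g := lpNorm p) 0 ?_
      (hasFDerivAt_update (0 : Fin d → ℝ) 0).differentiableAt
    have : Function.update (0 : Fin d → ℝ) i 0 = 0 := Function.update_eq_self i 0
    rwa [this]
  simp only [h1] at h2
  exact not_differentiableAt_abs_zero h2

end

section

variable {V : Type*} {p d : ℕ}

theorem edgeLength_eq (r : V → Fin d → ℝ) (e : Sym2 V) :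
    edgeLength p r e = lpNorm p (r (Quot.out e).1 - r (Quot.out e).2) := by
  conv_lhs => rw [← Quot.out_eq e]
  rfl

theorem edgeLength_pow (hp : 1 ≤ p) (r : V → Fin d → ℝ) (e : Sym2 V) :
    edgeLength p r e ^ p = ∑ i, |r (Quot.out e).1 i - r (Quot.out e).2 i| ^ p := by
  rw [edgeLength_eq, lpNorm_pow hp]
  rfl

theorem adj_out {H : SimpleGraph V} {e : Sym2 V} (he : e ∈ H.edgeSet) :
    H.Adj (Quot.out e).1 (Quot.out e).2 := by
  rw [← SimpleGraph.mem_edgeSet]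
  convert he
  exact Quot.out_eq e

/-- The vector of `p`-th powers of edge lengths of a framework. -/
noncomputable def edgePowers (p : ℕ) {d : ℕ} (H : SimpleGraph V) (r : V → Fin d → ℝ) : H.edgeSet → ℝ :=
  fun e => edgeLength p r e ^ p

theorem projectedStratum_eq_range (p d : ℕ) (G : SimpleGraph V) :
    projectedStratum p d G = Set.range (edgePowers p (d := d) G) := by
  rw [projectedStratum, stratum, ← Set.range_comp]
  rfl

theorem WellPositioned.edgeLength_ne_zero (hp : 1 ≤ p) {H : SimpleGraph V} {r : V → Fin d → ℝ}
    (hr : WellPositioned p H r) {e : Sym2 V} (he : e ∈ H.edgeSet) (i : Fin d) :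
    edgeLength p r e ≠ 0 := by
  rw [edgeLength_eq]
  intro h0
  refine ne_zero_of_differentiableAt_lpNorm hp (hr _ _ (adj_out he)) i ?_
  have h1 := lpNorm_pow hp (r (Quot.out e).1 - r (Quot.out e).2)
  rw [h0, zero_pow (by omega), eq_comm, Finset.sum_eq_zero_iff_of_nonneg
    (fun _ _ => by positivity)] at h1
  ext j
  exact abs_eq_zero.mp (pow_eq_zero_iff (by omega) |>.mp (h1 j (Finset.mem_univ j)))

theorem dimH_projectedStratum_mono {H G : SimpleGraph V} (hHG : H ≤ G) [Fintype H.edgeSet]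
    [Fintype G.edgeSet] : dimH (projectedStratum p d H) ≤ dimH (projectedStratum p d G) := by
  let φ : (G.edgeSet → ℝ) → (H.edgeSet → ℝ) :=
    fun δ e => δ ⟨e, SimpleGraph.edgeSet_mono hHG e.2⟩
  have hφ : LipschitzWith 1 φ := LipschitzWith.of_dist_le_mul fun x y => by
    rw [NNReal.coe_one, one_mul]
    exact (dist_pi_le_iff dist_nonneg).mpr fun e => dist_le_pi_dist x y _
  have himage : projectedStratum p d H = φ '' projectedStratum p d G := by
    rw [projectedStratum_eq_range, projectedStratum_eq_range, ← Set.range_comp]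
    rfl
  rw [himage]
  exact hφ.dimH_image_le _

variable [Fintype V]

theorem WellPositioned.differentiableAt_edgeLength {H : SimpleGraph V} {r : V → Fin d → ℝ}
    (hr : WellPositioned p H r) {e : Sym2 V} (he : e ∈ H.edgeSet) :
    DifferentiableAt ℝ (fun s : V → Fin d → ℝ => edgeLength p s e) r := by
  simp only [edgeLength_eq]
  exact DifferentiableAt.comp (g := lpNorm p) r (hr _ _ (adj_out he))
    ((differentiableAt_apply _ r).sub (differentiableAt_apply _ r))

theorem WellPositioned.hasFDerivAt_edgeLength_pow {H : SimpleGraph V} {r : V → Fin d → ℝ}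
    (hr : WellPositioned p H r) {e : Sym2 V} (he : e ∈ H.edgeSet) :
    HasFDerivAt (fun s : V → Fin d → ℝ => edgeLength p s e ^ p)
      ((p * edgeLength p r e ^ (p - 1)) •
        fderiv ℝ (fun s : V → Fin d → ℝ => edgeLength p s e) r) r := by
  simpa using (hr.differentiableAt_edgeLength he).hasFDerivAt.pow p

theorem WellPositioned.contDiffAt_edgePowers (hp : 1 ≤ p) {H : SimpleGraph V} [Fintype H.edgeSet]
    {r : V → Fin d → ℝ} (hr : WellPositioned p H r) : ContDiffAt ℝ 1 (edgePowers p H) r := by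
  rw [contDiffAt_pi]
  intro e
  simp only [edgePowers, edgeLength_pow hp]
  refine ContDiffAt.sum fun i _ => ?_
  refine ContDiffAt.comp (g := fun t : ℝ => |t| ^ p) r (contDiffAt_abs_pow ?_) (by fun_prop)
  rcases hp.eq_or_lt with rfl | hp
  · exact Or.inr (ne_zero_of_differentiableAt_lpNorm_one (hr _ _ (adj_out e.2)) i)
  · exact Or.inl hp

variable [DecidableEq V]

theorem WellPositioned.fderiv_edgePowers_surjective (hp : 1 ≤ p) {H : SimpleGraph V}
    [Fintype H.edgeSet] {r : V → Fin d → ℝ} (hr : WellPositioned p H r)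
    (hli : LinearIndependent ℝ (rigidityMatrix p H r).row) :
    Function.Surjective (fderiv ℝ (edgePowers p H) r) := by
  classical
  have happ : ∀ v e, fderiv ℝ (edgePowers p H) r v e = (p * edgeLength p r e ^ (p - 1)) *
      fderiv ℝ (fun s : V → Fin d → ℝ => edgeLength p s e) r v := by
    intro v e
    have h1 : HasFDerivAt (edgePowers p H) (ContinuousLinearMap.pi fun e : H.edgeSet =>
        (p * edgeLength p r e ^ (p - 1)) •
          fderiv ℝ (fun s : V → Fin d → ℝ => edgeLength p s e) r) r :=
      hasFDerivAt_pi.mpr fun e => hr.hasFDerivAt_edgeLength_pow e.2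
    rw [h1.fderiv]
    simp
  let A : (V → Fin d → ℝ) →ₗ[ℝ] (H.edgeSet → ℝ) := (fderiv ℝ (edgePowers p H) r : _ →ₗ[ℝ] _)
  change Function.Surjective A
  rw [← LinearMap.dualMap_injective_iff, injective_iff_map_eq_zero]
  intro f hf
  have hsum : ∑ e : H.edgeSet, (f (Pi.single e 1) * (p * edgeLength p r e ^ (p - 1))) •
      (rigidityMatrix p H r).row e = 0 := by
    ext c
    have h1 := LinearMap.congr_fun hf (Pi.single c.1 (Pi.single c.2 1))
    rw [LinearMap.dualMap_apply, LinearMap.zero_apply,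
      LinearMap.pi_apply_eq_sum_univ f] at h1
    rw [Finset.sum_apply, Pi.zero_apply, ← h1]
    refine Finset.sum_congr rfl fun e _ => ?_
    have h2 : A (Pi.single c.1 (Pi.single c.2 1)) e = _ := happ _ e
    have h3 : (fun j => if e = j then (1 : ℝ) else 0) = Pi.single e 1 := by
      ext j
      simp [Pi.single_apply, eq_comm]
    rw [h2, h3]
    simp only [Pi.smul_apply, smul_eq_mul, Matrix.row, rigidityMatrix, Matrix.of_apply]
    ring
  have hcoef := Fintype.linearIndependent_iff.mp hli _ hsum
  refine LinearMap.pi_ext' fun e => LinearMap.ext_ring ?_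
  -- An independent row is nonzero, hence has a column; this supplies a coordinate and excludes `d =
  -- 0`.
  obtain ⟨c, -⟩ := Function.ne_iff.mp (hli.ne_zero e)
  have hne : (p * edgeLength p r e ^ (p - 1) : ℝ) ≠ 0 :=
    mul_ne_zero (by positivity) (pow_ne_zero _ (hr.edgeLength_ne_zero hp e.2 c.2))
  simpa using (mul_eq_zero.mp (hcoef e)).resolve_right hne

theorem IsIndependent.ncard_le_dimH (hp : 1 ≤ p) {H : SimpleGraph V} [Fintype H.edgeSet]
    (hH : IsIndependent p d H) :
    (H.edgeSet.ncard : ℝ≥0∞) ≤ dimH (projectedStratum p d H) := by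
  obtain ⟨r, hr, hli⟩ := hH
  have hstrict := (hr.1.contDiffAt_edgePowers hp).hasStrictFDerivAt one_ne_zero
  have hmap := hstrict.map_nhds_eq_of_surj
    (LinearMap.range_eq_top.mpr (hr.1.fderiv_edgePowers_surjective hp hli))
  have hmem : Set.range (edgePowers p (d := d) H) ∈ nhds (edgePowers p H r) := by
    rw [← hmap]
    exact Filter.range_mem_map
  rw [projectedStratum_eq_range, Real.dimH_of_mem_nhds hmem, Module.finrank_fintype_fun_eq_card,
    Set.ncard_eq_toFinset_card', Set.toFinset_card]

theorem rigidityRank_le_dimH (hp : 1 ≤ p) (G : SimpleGraph V) [Fintype G.edgeSet] :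
    (rigidityRank p d G : ℝ≥0∞) ≤ dimH (projectedStratum p d G) := by
  classical
  rw [rigidityRank]
  set S := {k | ∃ H : SimpleGraph V, H ≤ G ∧ IsIndependent p d H ∧ H.edgeSet.ncard = k}
  rcases S.eq_empty_or_nonempty with h | h
  · simp [h]
  · have hbdd : BddAbove S := by
      refine ⟨G.edgeSet.ncard, ?_⟩
      rintro _ ⟨H, hHG, -, rfl⟩
      exact Set.ncard_le_ncard (SimpleGraph.edgeSet_mono hHG) (Set.toFinite _)
    obtain ⟨H, hHG, hH, hk⟩ := Nat.sSup_mem h hbdd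
    rw [← hk]
    exact (hH.ncard_le_dimH hp).trans (dimH_projectedStratum_mono hHG)

end

end LpRigidity

/-! ### Sign patterns and the upper bound -/

namespace LpRigidity

section

variable {V : Type*} {p d : ℕ}

/-- The signs of the coordinates of all differences of points of `g`. -/
noncomputable def signPattern (g : V → Fin d → ℝ) (u v : V) (i : Fin d) : SignType :=
  SignType.sign (g u i - g v i)

/-- The polynomial which agrees with the `p`-th power of the length of `e` on the frameworks
with sign pattern `s`. -/
noncomputable def signPolynomial (p : ℕ) (s : V → V → Fin d → SignType) (e : Sym2 V) :
    MvPolynomial (V × Fin d) ℝ :=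
  ∑ i, (MvPolynomial.C ((s (Quot.out e).1 (Quot.out e).2 i : SignType) : ℝ) *
    (MvPolynomial.X ((Quot.out e).1, i) - MvPolynomial.X ((Quot.out e).2, i))) ^ p

theorem eval_signPolynomial (hp : 1 ≤ p) {s : V → V → Fin d → SignType} {r : V → Fin d → ℝ}
    (h : ∀ u v i, |r u i - r v i| = s u v i * (r u i - r v i)) (e : Sym2 V) :
    MvPolynomial.eval (fun c => r c.1 c.2) (signPolynomial p s e) = edgeLength p r e ^ p := by
  simp [signPolynomial, edgeLength_pow hp, h]

theorem abs_eq_signPattern_mul (g : V → Fin d → ℝ) (u v : V) (i : Fin d) :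
    |g u i - g v i| = signPattern g u v i * (g u i - g v i) :=
  (sign_mul_self _).symm

-- A small perturbation `r + t q` breaks ties and preserves strict inequalities. Where `r` has a
-- tie, both sides are zero. Thus the closed cones of tie-free patterns cover all frameworks.
open Filter Topology in
theorem exists_injective_of_sign_mul [Finite V] (r : V → Fin d → ℝ) :
    ∃ g : V → Fin d → ℝ, (∀ u v, u ≠ v → ∀ i, g u i ≠ g v i) ∧
      ∀ u v i, |r u i - r v i| = signPattern g u v i * (r u i - r v i) := by
  obtain ⟨q, hq⟩ : ∃ q : V → ℝ, Function.Injective q :=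
    ⟨fun v => (Finite.equivFin V v : ℕ), fun u v h => by simpa [Fin.val_inj] using h⟩
  have hev : ∀ᶠ t in 𝓝[>] (0 : ℝ), ∀ u v i, r u i < r v i → r u i + t * q u < r v i + t * q v := by
    refine eventually_all.mpr fun u => eventually_all.mpr fun v => eventually_all.mpr fun i => ?_
    by_cases h : r u i < r v i
    · have hc : ContinuousAt (fun t : ℝ => r v i + t * q v - (r u i + t * q u)) 0 := by fun_prop
      have := hc.eventually_const_lt (u := 0) (by simpa using h)
      filter_upwards [nhdsWithin_le_nhds this] with t ht _
      linarith
    · exact Eventually.of_forall fun t ht => absurd ht h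
  obtain ⟨t, ht, ht0⟩ := (hev.and self_mem_nhdsWithin).exists
  refine ⟨fun v i => r v i + t * q v, fun u v huv i hi => ?_, fun u v i => ?_⟩
  · simp only at hi
    rcases lt_trichotomy (r u i) (r v i) with h | h | h
    · exact absurd hi (ht u v i h).ne
    · rw [h, add_right_inj] at hi
      exact huv (hq (mul_left_cancel₀ ht0.ne' hi))
    · exact absurd hi (ht v u i h).ne'
  · simp only [signPattern]
    rcases lt_trichotomy (r u i) (r v i) with h | h | h
    · rw [sign_neg (sub_neg.mpr (ht u v i h)), abs_of_neg (sub_neg.mpr h)]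
      simp
    · simp [h]
    · rw [sign_pos (sub_pos.mpr (ht v u i h)), abs_of_pos (sub_pos.mpr h)]
      simp

theorem wellPositioned_of_ne (hp : 1 ≤ p) (H : SimpleGraph V) {r : V → Fin d → ℝ}
    (hr : ∀ u v, u ≠ v → ∀ i, r u i ≠ r v i) : WellPositioned p H r := fun u v huv =>
  differentiableAt_lpNorm hp fun i => sub_ne_zero.mpr (hr u v huv.ne i)

theorem isOpen_setOf_signPattern [Finite V] (g : V → Fin d → ℝ) :
    IsOpen {x : V × Fin d → ℝ | ∀ u v, u ≠ v → ∀ i,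
      0 < (signPattern g u v i : ℝ) * (x (u, i) - x (v, i))} := by
  simp only [Set.ofPred_forall]
  refine isOpen_iInter_of_finite fun u => isOpen_iInter_of_finite fun v =>
    isOpen_iInter_of_finite fun _ => isOpen_iInter_of_finite fun i => ?_
  exact isOpen_lt continuous_const (by fun_prop)

variable [Fintype V] [DecidableEq V]

/-- Full row rank is already the maximum possible, so regularity is automatic. -/
theorem isIndependent_of_linearIndependent {H : SimpleGraph V} {r : V → Fin d → ℝ}
    (hr : WellPositioned p H r) (hli : LinearIndependent ℝ (rigidityMatrix p H r).row) :
    IsIndependent p d H := by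
  classical
  refine ⟨r, ⟨hr, fun s _ => ?_⟩, hli⟩
  rw [hli.rank_matrix]
  exact Matrix.rank_le_card_height _

theorem card_le_rigidityRank {H G : SimpleGraph V} (hHG : H ≤ G) (hH : IsIndependent p d H) :
    H.edgeSet.ncard ≤ rigidityRank p d G := by
  refine le_csSup ⟨G.edgeSet.ncard, ?_⟩ ⟨H, hHG, hH, rfl⟩
  rintro _ ⟨H', hHG', -, rfl⟩
  exact Set.ncard_le_ncard (SimpleGraph.edgeSet_mono hHG') (Set.toFinite _)

theorem le_rigidityRank_of_linearIndependent {G : SimpleGraph V} {r : V → Fin d → ℝ}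
    (hr : WellPositioned p G r) {m : ℕ} (e : Fin m → G.edgeSet)
    (hli : LinearIndependent ℝ fun i => (rigidityMatrix p G r).row (e i)) :
    m ≤ rigidityRank p d G := by
  have hinj : Function.Injective e := Function.Injective.of_comp hli.injective
  let H : SimpleGraph V := SimpleGraph.fromEdgeSet (Set.range fun i => (e i : Sym2 V))
  have hedge : H.edgeSet = Set.range fun i => (e i : Sym2 V) := by
    rw [SimpleGraph.edgeSet_fromEdgeSet, sdiff_eq_left, Set.disjoint_left]
    rintro _ ⟨i, rfl⟩ hdiag
    exact G.not_isDiag_of_mem_edgeSet (e i).2 hdiag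
  have hHG : H ≤ G := by
    rw [← SimpleGraph.edgeSet_subset_edgeSet, hedge]
    rintro _ ⟨i, rfl⟩
    exact (e i).2
  have hcard : H.edgeSet.ncard = m := by
    have hinj' : Function.Injective fun i => (e i : Sym2 V) := Subtype.val_injective.comp hinj
    rw [hedge, ← Set.image_univ, Set.ncard_image_of_injective _ hinj']
    simp
  rw [← hcard]
  refine card_le_rigidityRank hHG (isIndependent_of_linearIndependent
    (fun u v huv => hr u v (hHG huv)) ?_)
  have hpre : ∀ a : H.edgeSet, ∃ i, (e i : Sym2 V) = a := fun a =>
    hedge.subset a.2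
  choose φ hφ using hpre
  have hφinj : Function.Injective φ := fun a b hab => Subtype.ext (by rw [← hφ a, ← hφ b, hab])
  convert hli.comp φ hφinj using 1
  ext a c
  simp [Matrix.row, rigidityMatrix, hφ]

/-- The polynomial and `ℓ_e ^ p` coincide on an open cone around `r`, so their derivatives there
agree. -/
theorem pderiv_signPolynomial (hp : 1 ≤ p) {G : SimpleGraph V} {g r : V → Fin d → ℝ}
    (hr : ∀ u v, u ≠ v → ∀ i, 0 < (signPattern g u v i : ℝ) * (r u i - r v i))
    (hw : WellPositioned p G r) (e : G.edgeSet) (c : V × Fin d) :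
    MvPolynomial.eval (fun c => r c.1 c.2)
      (MvPolynomial.pderiv c (signPolynomial p (signPattern g) e)) =
      (p * edgeLength p r e ^ (p - 1)) * rigidityMatrix p G r e c := by
  have hev : (fun x : V → Fin d → ℝ => MvPolynomial.eval (fun c => x c.1 c.2)
      (signPolynomial p (signPattern g) e)) =ᶠ[nhds r] fun x => edgeLength p x e ^ p := by
    have hcont : Continuous fun (x : V → Fin d → ℝ) (c : V × Fin d) => x c.1 c.2 := by fun_prop
    filter_upwards [((isOpen_setOf_signPattern g).preimage hcont).mem_nhds hr] with x hx
    refine eval_signPolynomial hp (fun u v i => ?_) _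
    rcases eq_or_ne u v with rfl | huv
    · simp
    · have h1 := hx u v huv i
      rw [← abs_of_pos h1, abs_mul]
      have hne : signPattern g u v i ≠ 0 := fun h => by simp [h] at h1
      have : |((signPattern g u v i : SignType) : ℝ)| = 1 := by
        revert hne
        cases signPattern g u v i <;> simp
      rw [this, one_mul]
  let A : (V → Fin d → ℝ) →L[ℝ] (V × Fin d → ℝ) := ContinuousLinearMap.pi fun c =>
    (ContinuousLinearMap.proj (R := ℝ) (φ := fun _ : Fin d => ℝ) c.2).comp
      (ContinuousLinearMap.proj (R := ℝ) (φ := fun _ : V => Fin d → ℝ) c.1)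
  have h1 := (MvPolynomial.hasFDerivAt_eval (signPolynomial p (signPattern g) e) (A r)).comp r
    A.hasFDerivAt
  have h2 := (hw.hasFDerivAt_edgeLength_pow e.2).congr_of_eventuallyEq hev
  have h3 := DFunLike.congr_fun (h1.unique h2) (Pi.single c.1 (Pi.single c.2 1))
  have hA : ∀ s, A (Pi.single c.1 (Pi.single c.2 1)) s = if s = c then 1 else 0 := by
    intro s
    have : A (Pi.single c.1 (Pi.single c.2 1)) s =
      (Pi.single c.1 (Pi.single c.2 1) : V → Fin d → ℝ) s.1 s.2 := rfl
    rw [this]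
    by_cases hs1 : s.1 = c.1
    · by_cases hs2 : s.2 = c.2
      · rw [if_pos (Prod.ext hs1 hs2), hs1, hs2]; simp
      · rw [if_neg (fun h => hs2 (by rw [h])), hs1]; simp [hs2]
    · rw [if_neg (fun h => hs1 (by rw [h]))]; simp [hs1]
  have hAr : A r = fun c => r c.1 c.2 := rfl
  simpa [hA, hAr, rigidityMatrix] using h3

theorem dimH_range_signPolynomial_le (hp : 1 ≤ p) (G : SimpleGraph V) [Fintype G.edgeSet]
    {g : V → Fin d → ℝ} (hg : ∀ u v, u ≠ v → ∀ i, g u i ≠ g v i) :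
    dimH (Set.range fun (x : V × Fin d → ℝ) (e : G.edgeSet) =>
      MvPolynomial.eval x (signPolynomial p (signPattern g) e)) ≤ rigidityRank p d G := by
  classical
  set F : G.edgeSet → MvPolynomial (V × Fin d) ℝ :=
    fun e => signPolynomial p (signPattern g) e with hF
  obtain ⟨m, e, c, hdet, hmax⟩ :=
    Matrix.exists_maximal_minor (Matrix.of fun e s => MvPolynomial.pderiv s (F e))
  obtain ⟨C, hC⟩ := HasPolynomialGrowth.range_eval F e c hdet hmax
  refine hC.dimH_le.trans ?_
  -- The cone is open and contains `g`, so a nonzero minor cannot vanish identically on it.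
  obtain ⟨x, hx, hxdet⟩ := MvPolynomial.exists_mem_eval_ne_zero_of_isOpen hdet
    (isOpen_setOf_signPattern g) ⟨fun c => g c.1 c.2, fun u v huv i => by
      rw [← abs_eq_signPattern_mul]
      exact abs_pos.mpr (sub_ne_zero.mpr (hg u v huv i))⟩
  set r : V → Fin d → ℝ := fun v i => x (v, i) with hr
  have hw : ∀ H : SimpleGraph V, WellPositioned p H r := fun H =>
    wellPositioned_of_ne hp H fun u v huv i h => by
      have := hx u v huv i
      rw [show x (u, i) = x (v, i) from h] at this
      simp at this
  have hpd := pderiv_signPolynomial (r := r) hp hx (hw G)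
  suffices h : m ≤ rigidityRank p d G by exact_mod_cast h
  refine le_rigidityRank_of_linearIndependent (hw G) e (LinearIndependent.of_eq_smul
    (v := fun i s => MvPolynomial.eval x (MvPolynomial.pderiv s (F (e i))))
    (fun i => p * edgeLength p r (e i) ^ (p - 1)) (fun i => ?_) ?_)
  · ext s
    exact hpd (e i) s
  · refine LinearIndependent.of_comp (LinearMap.funLeft ℝ ℝ c) ?_
    rw [RingHom.map_det] at hxdet
    exact Matrix.linearIndependent_rows_of_det_ne_zero hxdet

theorem dimH_le_rigidityRank (hp : 1 ≤ p) (G : SimpleGraph V) [Fintype G.edgeSet] :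
    dimH (projectedStratum p d G) ≤ rigidityRank p d G := by
  have hsub : projectedStratum p d G ⊆
      ⋃ s : {s : V → V → Fin d → SignType //
          ∃ g : V → Fin d → ℝ, (∀ u v, u ≠ v → ∀ i, g u i ≠ g v i) ∧ signPattern g = s},
        Set.range fun (x : V × Fin d → ℝ) (e : G.edgeSet) =>
          MvPolynomial.eval x (signPolynomial p s.1 e) := by
    rw [projectedStratum_eq_range]
    rintro _ ⟨r, rfl⟩
    obtain ⟨g, hg, hrg⟩ := exists_injective_of_sign_mul r
    exact Set.mem_iUnion.mpr ⟨⟨signPattern g, g, hg, rfl⟩, fun c => r c.1 c.2,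
      funext fun e => eval_signPolynomial hp hrg e⟩
  refine (dimH_mono hsub).trans ?_
  rw [dimH_iUnion]
  refine iSup_le ?_
  rintro ⟨_, g, hg, rfl⟩
  exact dimH_range_signPolynomial_le hp G hg

end

end LpRigidity

theorem mainTheorem4 {V : Type*} [Fintype V] [DecidableEq V] (G : SimpleGraph V)
    [Fintype G.edgeSet] (p d : ℕ) (hp : 1 ≤ p) :
    dimH (LpRigidity.projectedStratum p d G) = (LpRigidity.rigidityRank p d G : ℝ≥0∞) :=
  le_antisymm (LpRigidity.dimH_le_rigidityRank hp G) (LpRigidity.rigidityRank_le_dimH hp G)
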